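/- Let $n\ge 1$, let $\Gamma$ be a discrete group, and let $\rho\colon\Gamma\to PU(n)=U(n)/Z(U(n))$ be a group homomorphism (a projective representation). Choose any set-theoretic lift $\widetilde\rho\colon\Gamma\to U(n)$ of $\rho$, let $$z(\gamma,\gamma')=\widetilde\rho(\gamma)\,\widetilde\rho(\gamma')\,\widetilde\rho(\gamma\gamma')^{-1},\qquad z\in Z^2(\Gamma,Z(U(n))),$$ be the corresponding 2-cocycle, where $\Gamma$ acts trivially on the center $Z(U(n))$, and let $\overline z\in H^2(\Gamma,Z(U(n)))$ be its cohomology class. Let $U(n)\rtimes\Gamma$ be the semidirect product for the action of $\Gamma$ on $U(n)$ in which $\gamma$ acts by $x\mapsto\widetilde\rho(\gamma)\,x\,\widetilde\rho(\gamma)^{-1}$. Automorphisms of $U(n)$ and of $U(n)\rtimes\Gamma$ are automorphisms of topological groups, and an automorphism of $U(n)$ is called outer if it is not inner. An automorphism $\alpha$ of $U(n)$ lifts to $U(n)\rtimes\Gamma$ if some automorphism of $U(n)\rtimes\Gamma$ restricts to $\alpha$ on $U(n)$. Entrywise complex conjugation is an outer automorphism of $U(n)$, and for every outer automorphism $\sigma$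 of $U(n)$ (for example complex conjugation) the following conditions are equivalent: (a) every automorphism of $U(n)$ lifts to $U(n)\rtimes\Gamma$; (b) every outer automorphism of $U(n)$ lifts to $U(n)\rtimes\Gamma$; (c) $\sigma$ lifts to $U(n)\rtimes\Gamma$; (d) $\overline z^{-1}$ lies in the orbit of $\overline z$ under the action of $\mathrm{Aut}(\Gamma)$ on $H^2(\Gamma,Z(U(n)))$. -/

import Mathlib

/-- The unitary group `U(n)`, with its usual topology as a group of complex matrices. -/
abbrev U (n : ℕ) : Type := Matrix.unitaryGroup (Fin n) ℂ

/-- The projective unitary group `PU(n) = U(n) / Z(U(n))`. -/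
abbrev PU (n : ℕ) : Type := U n ⧸ Subgroup.center (U n)

/-! ### Automorphisms of topological groups -/

/-- Inner automorphisms of a topological group. -/
def IsInnerAut {G : Type*} [Group G] [TopologicalSpace G] (α : G ≃ₜ* G) : Prop :=
  ∃ g : G, ∀ x : G, α x = g * x * g⁻¹

/-- Outer automorphisms, that is, the automorphisms which are not inner. -/
def IsOuterAut {G : Type*} [Group G] [TopologicalSpace G] (α : G ≃ₜ* G) : Prop :=
  ¬ IsInnerAut α

/-- Entrywise complex conjugation, as an automorphism of the topological group `U(n)`. -/
def complexConj (n : ℕ) : U n ≃ₜ* U n where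
  toFun := Matrix.UnitaryGroup.map_star
  invFun := Matrix.UnitaryGroup.map_star
  left_inv A := by ext i j; simp
  right_inv A := by ext i j; simp
  map_mul' A B := by
    ext i j
    simp [Matrix.mul_apply]
  continuous_toFun :=
    Continuous.subtype_mk (continuous_subtype_val.matrix_map continuous_star) _
  continuous_invFun :=
    Continuous.subtype_mk (continuous_subtype_val.matrix_map continuous_star) _

/-! ### The semidirect product attached to a projective representation -/

/-- The conjugation action of `G / Z(G)` on `G`. -/
def conjModCenter (G : Type*) [Group G] : G ⧸ Subgroup.center G →* MulAut G :=
  QuotientGroup.lift (Subgroup.center G) MulAut.conj (by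
    intro g hg
    ext x
    rw [MulAut.conj_apply, MulAut.one_apply, ← Subgroup.mem_center_iff.1 hg x, mul_assoc,
      mul_inv_cancel, mul_one])

theorem conjModCenter_mk {G : Type*} [Group G] (g x : G) :
    conjModCenter G (g : G ⧸ Subgroup.center G) x = g * x * g⁻¹ := rfl

/-- The action of `Γ` on `G` by conjugation induced by a projective representation
`ρ : Γ → G / Z(G)`: for any `g : G` lifting `ρ γ`, the element `γ` acts as `x ↦ g x g⁻¹`. -/
def projAction {G Γ : Type*} [Group G] [Group Γ] (ρ : Γ →* G ⧸ Subgroup.center G) :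
    Γ →* MulAut G :=
  (conjModCenter G).comp ρ

/-- The semidirect product `G ⋊ Γ` attached to a projective representation of `Γ` in `G`. -/
abbrev ProjSemidirect {G Γ : Type*} [Group G] [Group Γ]
    (ρ : Γ →* G ⧸ Subgroup.center G) : Type _ :=
  G ⋊[projAction ρ] Γ

/-- The underlying space of a semidirect product is the product space. -/
instance semidirectTopology {N H : Type*} [Group N] [Group H] [TopologicalSpace N]
    [TopologicalSpace H] (φ : H →* MulAut N) : TopologicalSpace (N ⋊[φ] H) :=
  TopologicalSpace.induced (fun x => (x.left, x.right)) inferInstance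

/-- The automorphism `α` of `G` lifts to an automorphism of `G ⋊ Γ`: some automorphism of the
topological group `G ⋊ Γ` restricts to `α` along the canonical embedding of `G`. -/
def LiftsToSemidirect {G Γ : Type*} [Group G] [TopologicalSpace G] [Group Γ] [TopologicalSpace Γ]
    (ρ : Γ →* G ⧸ Subgroup.center G) (α : G ≃ₜ* G) : Prop :=
  ∃ Φ : ProjSemidirect ρ ≃ₜ* ProjSemidirect ρ,
    ∀ x : G, Φ (SemidirectProduct.inl x) = SemidirectProduct.inl (α x)

/-! ### Second cohomology with trivial coefficients -/

universe u

section Cohomology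

open groupCohomology CategoryTheory
open scoped IsMulCommutative

/-- The abelian group `M`, written additively, with the trivial action of `Γ`. The lifts to the
universe of `Γ` are there only because group cohomology is set up within one universe. -/
noncomputable abbrev trivialCoeff (Γ : Type u) [Group Γ] (M : Type) [CommGroup M] :
    Rep.{u} (ULift.{u} ℤ) Γ :=
  Rep.trivial (ULift.{u} ℤ) Γ (ULift.{u} (Additive M))

/-- The cohomology group `H²(Γ, M)` for the trivial action of `Γ` on `M`, written additively. -/
noncomputable abbrev TrivH2 (Γ : Type u) [Group Γ] (M : Type) [CommGroup M] : Type u :=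
  groupCohomology.H2 (trivialCoeff Γ M)

/-- The map on `H²(Γ, M)` induced by an endomorphism `f` of `Γ`: on cocycles it is
`z ↦ ((γ, γ') ↦ z (f γ, f γ'))`. -/
noncomputable def pullbackH2 {Γ : Type u} [Group Γ] (M : Type) [CommGroup M] (f : Γ →* Γ) :
    groupCohomology.H2 (trivialCoeff Γ M) ⟶ groupCohomology.H2 (trivialCoeff Γ M) :=
  groupCohomology.map f
    (Rep.ofHom ⟨LinearMap.id, fun _ => rfl⟩ : Rep.res f (trivialCoeff Γ M) ⟶ trivialCoeff Γ M) 2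

theorem pullbackH2_id {Γ : Type u} [Group Γ] (M : Type) [CommGroup M] :
    pullbackH2 M (MonoidHom.id Γ) = 𝟙 _ :=
  groupCohomology.map_id 2

theorem pullbackH2_comp {Γ : Type u} [Group Γ] (M : Type) [CommGroup M] (f g : Γ →* Γ) :
    pullbackH2 M (f.comp g) = pullbackH2 M f ≫ pullbackH2 M g := by
  unfold pullbackH2
  rw [← groupCohomology.map_comp]
  exact groupCohomology.map_congr rfl rfl 2

/-- The action of `Aut(Γ)` on `H²(Γ, M)`: an automorphism `θ` takes the class of `z` to the class
of `(γ, γ') ↦ z (θ⁻¹ γ, θ⁻¹ γ')`. -/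
noncomputable instance autActionH2 (Γ : Type u) [Group Γ] (M : Type) [CommGroup M] :
    MulAction (MulAut Γ) (TrivH2 Γ M) where
  smul θ c := (pullbackH2 M (θ⁻¹ : MulAut Γ).toMonoidHom).hom c
  one_smul c := by
    change (pullbackH2 M (MonoidHom.id Γ)).hom c = c
    rw [pullbackH2_id]
    rfl
  mul_smul θ η c := by
    change (pullbackH2 M ((η⁻¹ : MulAut Γ).toMonoidHom.comp (θ⁻¹ : MulAut Γ).toMonoidHom)).hom c = _
    rw [pullbackH2_comp]
    rfl

/-! ### The cocycle of a projective representation -/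

/-- For a set-theoretic lift `r : Γ → G` of `ρ`, the central element
`r(γ) r(γ') r(γγ')⁻¹`. -/
def projCocycle {G : Type} {Γ : Type u} [Group G] [Group Γ] (ρ : Γ →* G ⧸ Subgroup.center G)
    (r : Γ → G) (hr : ∀ γ, (r γ : G ⧸ Subgroup.center G) = ρ γ) (p : Γ × Γ) :
    Subgroup.center G :=
  ⟨r p.1 * r p.2 * (r (p.1 * p.2))⁻¹, by
    rw [← QuotientGroup.eq_one_iff]
    simp [hr]⟩

/-- The 2-cocycle `z(γ, γ') = r(γ) r(γ') r(γγ')⁻¹` in `Z²(Γ, Z(G))`. -/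
def projCocycle₂ {G : Type} {Γ : Type u} [Group G] [Group Γ] (ρ : Γ →* G ⧸ Subgroup.center G)
    (r : Γ → G) (hr : ∀ γ, (r γ : G ⧸ Subgroup.center G) = ρ γ) :
    cocycles₂ (trivialCoeff Γ (Subgroup.center G)) :=
  ⟨fun p => ULift.up (Additive.ofMul (projCocycle ρ r hr p)), by
    rw [mem_cocycles₂_iff]
    intro g h j
    have key : projCocycle ρ r hr (g * h, j) * projCocycle ρ r hr (g, h) =
        projCocycle ρ r hr (h, j) * projCocycle ρ r hr (g, h * j) := by
      have hc := Subgroup.mem_center_iff.1 (projCocycle ρ r hr (g, h)).2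
      have hd := Subgroup.mem_center_iff.1 (projCocycle ρ r hr (h, j)).2
      apply Subtype.ext
      rw [mul_comm]
      simp only [Subgroup.coe_mul]
      have hd' := hd (r g)
      simp only [projCocycle] at hd' ⊢
      calc _ = r g * (r h * r j * (r (h * j))⁻¹) * r (h * j) * (r (g * (h * j)))⁻¹ := by
            rw [mul_assoc g h j]; group
        _ = _ := by rw [hd']; group
    exact congrArg (fun x => ULift.up (Additive.ofMul x)) key⟩

/-- The cohomology class `z̄` in `H²(Γ, Z(G))` of the 2-cocycle of a projective representation. -/
noncomputable def projClass {G : Type} {Γ : Type u} [Group G] [Group Γ]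
    (ρ : Γ →* G ⧸ Subgroup.center G)
    (r : Γ → G) (hr : ∀ γ, (r γ : G ⧸ Subgroup.center G) = ρ γ) :
    TrivH2 Γ (Subgroup.center G) :=
  (H2π (trivialCoeff Γ (Subgroup.center G))).hom (projCocycle₂ ρ r hr)

end Cohomology

/-!
An automorphism `α` of `U(n)` restricts to the center, a circle, as `z ↦ z` or `z ↦ z⁻¹`. In the
first case `α` is inner. Indeed, by simultaneous diagonalization `α` maps the diagonal torus into a
conjugate of itself, hence acts on it through an integer matrix `M` of weights. The character of
`α` is invariant under the Weyl group, so the Gram matrix `Mᵀ * M` is invariant under permutations;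
as `M` is unimodular with rows summing to one, this forces `Mᵀ * M = 1`, and `M` is a permutation
matrix. So `α`, as a representation, has the character of the standard one, hence is conjugate
to it. Consequently every outer automorphism inverts the center.

A lift of `α` to `G ⋊ Γ` has the form `(x, γ) ↦ (α x * a γ, θ γ)`, where `a γ` is
`α (r γ) * (r (θ γ))⁻¹` up to a central factor `c γ`. When `α` inverts the center, the condition on
`a` says that the coboundary of `c` is the product of `z` and its pullback along `θ`, so that `α`
lifts exactly when `z̄⁻¹` is in the orbit of `z̄`.
-/

open scoped Matrix ComplexStarModule
open Matrix (diagonal unitaryGroup)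

section CircleCharacters

open MeasureTheory

theorem fourierCoeff_mul_eq_of_map_add {T : ℝ} [Fact (0 < T)] {f : AddCircle T → ℂ}
    (hf : ∀ a x, f (a + x) = f a * f x) (k : ℤ) (a : AddCircle T) :
    fourier (-k) a * f a * fourierCoeff f k = fourierCoeff f k := by
  simp only [fourierCoeff]
  conv_rhs => rw [← integral_add_left_eq_self _ a]
  rw [← integral_const_mul]
  refine integral_congr_ae (.of_forall fun x => ?_)
  simp only [hf a x, fourier_apply, smul_add, AddCircle.toCircle_add, Circle.coe_mul, smul_eq_mul]
  ring

theorem exists_fourierCoeff_ne_zero {T : ℝ} [Fact (0 < T)] {f : C(AddCircle T, ℂ)} (hf : f ≠ 0) :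
    ∃ k, fourierCoeff f k ≠ 0 := by
  by_contra! h
  have hsum : Summable (fourierCoeff f) := by
    rw [funext h]
    exact summable_zero
  have h0 := hasSum_fourier_series_of_summable hsum
  simp only [h, zero_smul] at h0
  exact hf (h0.unique hasSum_zero)

/-- The Fourier coefficients of a character are its inner products with the powers; one of them is
nonzero, and translation invariance shows that the character is that power. -/
theorem exists_eq_zpow_of_continuous {χ : Circle →* Circle} (hχ : Continuous χ) :
    ∃ k : ℤ, ∀ z, χ z = z ^ k := by
  have : Fact (0 < 2 * Real.pi) := ⟨Real.two_pi_pos⟩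
  let f : C(AddCircle (2 * Real.pi), ℂ) :=
    ⟨fun x => χ x.toCircle, by have := AddCircle.continuous_toCircle (T := 2 * Real.pi); fun_prop⟩
  have hf : ∀ a x, f (a + x) = f a * f x := fun a x => by simp [f, AddCircle.toCircle_add]
  have hf0 : f ≠ 0 := fun h => Circle.coe_ne_zero (χ 1) <| by
    simpa [f] using congrArg (fun g : C(_, ℂ) => g 0) h
  obtain ⟨k, hk⟩ := exists_fourierCoeff_ne_zero hf0
  refine ⟨k, fun z => ?_⟩
  obtain ⟨a, rfl⟩ : ∃ a : AddCircle (2 * Real.pi), a.toCircle = z :=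
    (AddCircle.homeomorphCircle Real.two_pi_pos.ne').surjective z |>.imp fun a ha => by
      rw [← AddCircle.homeomorphCircle_apply Real.two_pi_pos.ne', ha]
  have h1 : (fourier (-k) a : ℂ) * f a = 1 :=
    mul_right_cancel₀ hk ((fourierCoeff_mul_eq_of_map_add hf k a).trans (one_mul _).symm)
  rw [fourier_apply, neg_smul, AddCircle.toCircle_neg, AddCircle.toCircle_zsmul] at h1
  exact (inv_mul_eq_one.mp (Circle.ext (by simpa [f] using h1))).symm

theorem eq_of_forall_circle_zpow_eq {k l : ℤ} (h : ∀ z : Circle, z ^ k = z ^ l) : k = l := by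
  by_contra hne
  have h0 : (k : ℝ) - l ≠ 0 := sub_ne_zero.mpr (mod_cast hne)
  have h1 : Circle.exp (Real.pi / (k - l)) ^ (k - l) = 1 := by
    rw [zpow_sub, h, mul_inv_cancel]
  rw [← Circle.exp_intCast_mul, Int.cast_sub, mul_div_cancel₀ _ h0, Circle.ext_iff,
    Circle.coe_exp, Complex.exp_pi_mul_I, Circle.coe_one] at h1
  norm_num at h1

end CircleCharacters

section TorusCharacters

theorem addChar_map_sum {κ A M : Type*} [AddCommMonoid A] [CommMonoid M] (ψ : AddChar A M)
    (f : κ → A) (s : Finset κ) : ψ (∑ i ∈ s, f i) = ∏ i ∈ s, ψ (f i) :=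
  map_prod ψ.toMonoidHom (fun i => Multiplicative.ofAdd (f i)) s

variable {ι κ : Type*} [Fintype ι] [Fintype κ]

/-- The character of the torus with weight `m`. -/
noncomputable def torusChar (m : ι → ℤ) : (ι → Circle) →* Circle where
  toFun s := ∏ i, s i ^ m i
  map_one' := by simp only [Pi.one_apply, one_zpow, Finset.prod_const_one]
  map_mul' s t := by simp only [Pi.mul_apply, mul_zpow, Finset.prod_mul_distrib]

theorem torusChar_apply (m : ι → ℤ) (s : ι → Circle) : torusChar m s = ∏ i, s i ^ m i := rfl

theorem torusChar_const (m : ι → ℤ) (z : Circle) :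
    torusChar m (fun _ => z) = z ^ ∑ i, m i :=
  (map_prod (zpowersHom Circle z) (fun i => Multiplicative.ofAdd (m i)) Finset.univ).symm

theorem torusChar_comp_perm (m : ι → ℤ) (w : Equiv.Perm ι) (s : ι → Circle) :
    torusChar m (s ∘ w.symm) = torusChar (m ∘ w) s := by
  simp only [torusChar_apply, Function.comp_apply]
  rw [← Equiv.prod_comp w]
  simp only [Equiv.symm_apply_apply]

theorem torusChar_toCircle {p : ℕ} [NeZero p] (m : ι → ℤ) (v : ι → ZMod p) :
    torusChar m (fun i => ZMod.toCircle (v i)) = ZMod.toCircle (∑ i, (m i : ZMod p) * v i) := by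
  simp only [torusChar_apply, ← AddChar.map_zsmul_eq_zpow, zsmul_eq_mul, addChar_map_sum]

theorem torusChar_mulSingle [DecidableEq ι] (m : ι → ℤ) (i : ι) (z : Circle) :
    torusChar m (Pi.mulSingle i z) = z ^ m i := by
  rw [torusChar_apply, Finset.prod_eq_single i, Pi.mulSingle_eq_same]
  · intro k _ hk
    rw [Pi.mulSingle_eq_of_ne hk, one_zpow]
  · exact fun h => absurd (Finset.mem_univ i) h

theorem torusChar_single_one [DecidableEq ι] (i : ι) (s : ι → Circle) :
    torusChar (Pi.single i 1) s = s i := by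
  rw [torusChar_apply, Finset.prod_eq_single i, Pi.single_eq_same, zpow_one]
  · intro k _ hk
    rw [Pi.single_eq_of_ne hk, zpow_zero]
  · exact fun h => absurd (Finset.mem_univ i) h

theorem torusChar_injective : Function.Injective (torusChar : (ι → ℤ) → _) := by
  classical
  intro m m' h
  funext i
  refine eq_of_forall_circle_zpow_eq fun z => ?_
  rw [← torusChar_mulSingle, h, torusChar_mulSingle]

theorem exists_eq_torusChar_of_continuous {χ : (ι → Circle) →* Circle} (hχ : Continuous χ) :
    ∃ m : ι → ℤ, χ = torusChar m := by
  classical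
  have h : ∀ i, ∃ k : ℤ, ∀ z, χ (Pi.mulSingle i z) = z ^ k := fun i =>
    exists_eq_zpow_of_continuous (χ := χ.comp (MonoidHom.mulSingle (fun _ => Circle) i))
      (hχ.comp (continuous_mulSingle (A := fun _ => Circle) i))
  choose m hm using h
  refine ⟨m, MonoidHom.pi_ext fun i z => ?_⟩
  rw [hm, torusChar_mulSingle]

theorem sum_apply_eq_of_sum_torusChar_eq {A : Type*} [AddCommGroup A] {m m' : κ → ι → ℤ}
    (h : ∀ s, ∑ j, (torusChar (m j) s : ℂ) = ∑ j, (torusChar (m' j) s : ℂ)) (F : (ι → ℤ) → A) :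
    ∑ j, F (m j) = ∑ j, F (m' j) := by
  have hinj : Function.Injective fun m : ι → ℤ => Circle.coeHom.comp (torusChar m) :=
    fun _ _ h => torusChar_injective <|
      MonoidHom.ext fun s => Circle.coe_injective (DFunLike.congr_fun h s)
  have hli : LinearIndependent ℤ fun (m : ι → ℤ) (s : ι → Circle) => (torusChar m s : ℂ) :=
    ((linearIndependent_monoidHom (ι → Circle) ℂ).comp _ hinj).restrict_scalars' ℤ
  have hsingle : ∑ j, Finsupp.single (m j) (1 : ℤ) = ∑ j, Finsupp.single (m' j) 1 := by
    refine hli (funext fun s => ?_)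
    simpa only [map_sum, Finsupp.linearCombination_single, one_smul, Finset.sum_apply] using h s
  simpa only [map_sum, Finsupp.linearCombination_single, one_smul] using
    congrArg (Finsupp.linearCombination ℤ F) hsingle

/-- A prime dividing the determinant yields a nonzero element of `p`-torsion in the kernel. -/
theorem isUnit_det_of_torusChar_injective [DecidableEq ι] {M : Matrix ι ι ℤ}
    (hM : Function.Injective fun s : ι → Circle => fun j => torusChar (M j) s) :
    IsUnit M.det := by
  rw [Int.isUnit_iff_natAbs_eq]
  by_contra hne
  obtain ⟨p, hp, hdvd⟩ := Nat.exists_prime_and_dvd hne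
  have : Fact p.Prime := ⟨hp⟩
  have hdet : (M.map (Int.castRingHom (ZMod p))).det = 0 :=
    (RingHom.map_det (Int.castRingHom (ZMod p)) M).symm.trans
      ((ZMod.intCast_zmod_eq_zero_iff_dvd _ _).mpr (Int.natCast_dvd.mpr hdvd))
  obtain ⟨v, hv, hMv⟩ := Matrix.exists_mulVec_eq_zero_iff.mpr hdet
  have h1 : (fun i => ZMod.toCircle (v i)) = 1 := hM <| funext fun j => by
    exact (torusChar_toCircle (M j) v).trans <|
      (congrArg ZMod.toCircle (congrFun hMv j)).trans ((AddChar.map_zero_eq_one _).trans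
        (map_one (torusChar (M j))).symm)
  exact hv <| funext fun i =>
    ZMod.injective_toCircle ((congrFun h1 i).trans (AddChar.map_zero_eq_one _).symm)

end TorusCharacters

section IntegerMatrices

variable {ι : Type*}

theorem exists_eq_diagonal_add_const [DecidableEq ι] {R : Type*} [AddCommGroup R]
    {G : Matrix ι ι R} (hG : ∀ w : Equiv.Perm ι, G.submatrix w w = G) :
    ∃ x y, G = Matrix.diagonal (fun _ => x) + Matrix.of fun _ _ => y := by
  have hinv : ∀ (w : Equiv.Perm ι) a b, G (w a) (w b) = G a b := fun w a b =>
    congrFun₂ (hG w) a b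
  have hdiag : ∀ a b, G a a = G b b := fun a b => by
    simpa only [Equiv.swap_apply_left] using (hinv (Equiv.swap a b) a a).symm
  rcases subsingleton_or_nontrivial ι with _ | _
  · rcases isEmpty_or_nonempty ι with _ | ⟨⟨a⟩⟩
    · exact ⟨0, 0, Subsingleton.elim _ _⟩
    · refine ⟨G a a, 0, ?_⟩
      ext i j
      simp [Subsingleton.elim i a, Subsingleton.elim j a]
  · obtain ⟨a, b, hab⟩ := exists_pair_ne ι
    refine ⟨G a a - G a b, G a b, ?_⟩
    ext i j
    rcases eq_or_ne i j with rfl | hij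
    · simp [hdiag i a]
    · have := Equiv.Perm.isMultiplyPretransitive ι 2
      obtain ⟨w, rfl, rfl⟩ := MulAction.is_two_pretransitive_iff (G := Equiv.Perm ι).mp this hab hij
      simpa [hab] using hinv w a b

variable [Fintype ι]

theorem mulVec_dotProduct_mulVec_self {R : Type*} [CommSemiring R] (M : Matrix ι ι R) (v : ι → R) :
    (M *ᵥ v) ⬝ᵥ (M *ᵥ v) = v ⬝ᵥ ((Mᵀ * M) *ᵥ v) := by
  rw [← Matrix.mulVec_mulVec, Matrix.dotProduct_mulVec v, Matrix.vecMul_transpose]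

theorem nonneg_of_transpose_mul_self_mulVec_eq_smul {R : Type*} [CommRing R] [LinearOrder R]
    [IsStrictOrderedRing R] {M : Matrix ι ι R} {v : ι → R} {x : R} (hv : v ≠ 0)
    (h : (Mᵀ * M) *ᵥ v = x • v) : 0 ≤ x := by
  have hnonneg : ∀ u : ι → R, 0 ≤ u ⬝ᵥ u := fun u => Finset.sum_nonneg fun _ _ => mul_self_nonneg _
  have hM := mulVec_dotProduct_mulVec_self M v
  rw [h, dotProduct_smul, smul_eq_mul] at hM
  exact nonneg_of_mul_nonneg_left (hM ▸ hnonneg _)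
    ((hnonneg v).lt_of_ne' (mt dotProduct_self_eq_zero.mp hv))

variable [DecidableEq ι]

theorem diagonal_add_const_mulVec {R : Type*} [NonUnitalNonAssocSemiring R] (x y : R) (v : ι → R) :
    (Matrix.diagonal (fun _ => x) + Matrix.of fun _ _ => y) *ᵥ v =
      fun i => x * v i + y * ∑ j, v j := by
  ext i
  rw [Matrix.add_mulVec, Pi.add_apply, Matrix.mulVec_diagonal, Finset.mul_sum]
  rfl

theorem isUnit_of_mulVec_eq_smul {R : Type*} [CommRing R] {A : Matrix ι ι R} (hA : IsUnit A.det)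
    {v : ι → R} {x : R} (hv : A *ᵥ v = x • v) {i : ι} (hi : IsUnit (v i)) : IsUnit x := by
  have hinv : x • (A⁻¹ *ᵥ v) = v := by
    rw [← Matrix.mulVec_smul, ← hv, Matrix.mulVec_mulVec, Matrix.nonsing_inv_mul _ hA,
      Matrix.one_mulVec]
  rw [← hinv, Pi.smul_apply, smul_eq_mul] at hi
  exact isUnit_of_mul_isUnit_left hi

/-- The Gram matrix is `x + y J`, where `J` is the all-ones matrix. It is unimodular and has the
eigenvalue `x` on the integral vector `e_a - e_b`, so `x` is a unit; it is positive, so `x = 1`. -/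
theorem transpose_mul_self_eq_one_of_submatrix_perm {M : Matrix ι ι ℤ} (hdet : IsUnit M.det)
    (hrow : ∀ j, ∑ i, M j i = 1) (hgram : ∀ w : Equiv.Perm ι, (Mᵀ * M).submatrix w w = Mᵀ * M) :
    Mᵀ * M = 1 := by
  rcases subsingleton_or_nontrivial ι with _ | _
  · have hM : M = 1 := by
      ext i j
      rw [Subsingleton.elim i j, Matrix.one_apply_eq, ← hrow j, Fintype.sum_subsingleton _ j]
    rw [hM, Matrix.transpose_one, mul_one]
  obtain ⟨x, y, hG⟩ := exists_eq_diagonal_add_const hgram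
  obtain ⟨a, b, hab⟩ := exists_pair_ne ι
  let v : ι → ℤ := Pi.single a 1 - Pi.single b 1
  have hv : (Mᵀ * M) *ᵥ v = x • v := by
    rw [hG, diagonal_add_const_mulVec]
    ext i
    simp [v]
  have hx : IsUnit x :=
    isUnit_of_mulVec_eq_smul (by simpa using hdet) hv (i := a) (by simp [v, hab])
  have hx0 : 0 ≤ x := nonneg_of_transpose_mul_self_mulVec_eq_smul
    (fun h => by simpa [v, hab] using congrFun h a) hv
  have hx1 : x = 1 := Int.isUnit_iff.mp hx |>.resolve_right (by rintro rfl; omega)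
  have hy0 : y = 0 := by
    have h := mulVec_dotProduct_mulVec_self M 1
    have hM1 : M *ᵥ 1 = 1 := by
      ext j
      simpa [Matrix.mulVec, dotProduct_one] using hrow j
    rw [hM1, hG, diagonal_add_const_mulVec, hx1] at h
    simpa [one_dotProduct, Finset.sum_add_distrib] using h
  rw [hG, hx1, hy0]
  ext i j
  simp [Matrix.one_apply]

theorem exists_eq_single_of_sum_eq_one {m : ι → ℤ} (hsum : ∑ i, m i = 1) (hsq : m ⬝ᵥ m = 1) :
    ∃ i, m = Pi.single i 1 := by
  obtain ⟨i, hi⟩ : ∃ i, 0 < m i := by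
    by_contra! h
    linarith [Finset.sum_nonpos fun i (_ : i ∈ Finset.univ) => h i]
  refine ⟨i, sub_eq_zero.mp (dotProduct_self_eq_zero.mp (le_antisymm ?_ ?_))⟩
  · have h : (m - Pi.single i 1) ⬝ᵥ (m - Pi.single i 1) = 2 - 2 * m i := by
      simp only [sub_dotProduct, dotProduct_sub, hsq, dotProduct_single_one, single_one_dotProduct,
        Pi.sub_apply, Pi.single_eq_same]
      ring
    linarith
  · exact Finset.sum_nonneg fun _ _ => mul_self_nonneg _

theorem exists_perm_of_transpose_mul_self_eq_one {M : Matrix ι ι ℤ} (hM : Mᵀ * M = 1)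
    (hrow : ∀ j, ∑ i, M j i = 1) : ∃ w : Equiv.Perm ι, ∀ j, M j = Pi.single (w j) 1 := by
  have horth : ∀ j k, M j ⬝ᵥ M k = (1 : Matrix ι ι ℤ) j k := fun j k =>
    congrFun₂ (f := M * Mᵀ) (mul_eq_one_comm.mp hM) j k
  choose f hf using fun j =>
    exists_eq_single_of_sum_eq_one (hrow j) ((horth j j).trans (Matrix.one_apply_eq j))
  have hinj : Function.Injective f := fun j k hjk => by
    by_contra hne
    have h := horth j k
    rw [hf j, hf k, hjk, Matrix.one_apply_ne hne, single_one_dotProduct, Pi.single_eq_same] at h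
    exact one_ne_zero h
  exact ⟨Equiv.ofBijective f (Finite.injective_iff_bijective.mp hinj), hf⟩

end IntegerMatrices

section SimultaneousDiagonalization

variable {κ 𝕜 : Type*} [RCLike 𝕜]

theorem exists_orthonormalBasis_forall_apply_eq_smul {E : Type*} [NormedAddCommGroup E]
    [InnerProductSpace 𝕜 E] [FiniteDimensional 𝕜 E] {ι : Type*} [Fintype ι]
    (hι : Module.finrank 𝕜 E = Fintype.card ι) {T : κ → Module.End 𝕜 E}
    (hT : ∀ k, (T k).IsSymmetric) (hcomm : Pairwise fun k l => Commute (T k) (T l)) :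
    ∃ b : OrthonormalBasis ι 𝕜 E, ∀ i k, ∃ c : 𝕜, T k (b i) = c • b i := by
  classical
  let V : (κ → 𝕜) → Submodule 𝕜 E := fun γ => ⨅ k, Module.End.eigenspace (T k) (γ k)
  have hV : DirectSum.IsInternal V :=
    LinearMap.IsSymmetric.directSum_isInternal_of_pairwise_commute hT hcomm
  let v := fun γ => stdOrthonormalBasis 𝕜 (V γ)
  let B := hV.collectedBasis fun γ => (v γ).toBasis
  have hB : Orthonormal 𝕜 B := by
    simpa [B] using (LinearMap.IsSymmetric.orthogonalFamily_iInf_eigenspaces hT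
      ).orthonormal_sigma_orthonormal (v_family := fun γ => v γ) fun γ => (v γ).orthonormal
  have : Fintype (Σ γ, Fin (Module.finrank 𝕜 (V γ))) := FiniteDimensional.fintypeBasisIndex B
  let e := Fintype.equivOfCardEq ((Module.finrank_eq_card_basis B).symm.trans hι)
  refine ⟨(B.toOrthonormalBasis hB).reindex e, fun i k => ⟨(e.symm i).1 k, ?_⟩⟩
  have hmem : B (e.symm i) ∈ V (e.symm i).1 := hV.collectedBasis_mem _ _
  rw [OrthonormalBasis.reindex_apply, Module.Basis.coe_toOrthonormalBasis]
  exact Module.End.mem_eigenspace_iff.mp ((Submodule.mem_iInf _).mp hmem k)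

variable {ι : Type*} [Fintype ι] [DecidableEq ι]

theorem exists_unitary_forall_isHermitian_mul_eq {A : κ → Matrix ι ι 𝕜}
    (hA : ∀ k, (A k).IsHermitian) (hcomm : Pairwise fun k l => Commute (A k) (A l)) :
    ∃ g : unitaryGroup ι 𝕜, ∀ k, ∃ d : ι → 𝕜, A k * g = g * diagonal d := by
  obtain ⟨b, hb⟩ := exists_orthonormalBasis_forall_apply_eq_smul (𝕜 := 𝕜) finrank_euclideanSpace
    (fun k => Matrix.isSymmetric_toEuclideanLin_iff.mpr (hA k))
    fun k l hkl => (hcomm hkl).map (Matrix.toLpLinAlgEquiv 2)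
  refine ⟨⟨_, (EuclideanSpace.basisFun ι 𝕜).toMatrix_orthonormalBasis_mem_unitary b⟩, fun k => ?_⟩
  choose c hc using fun i => hb i k
  refine ⟨c, ?_⟩
  ext i j
  have h := congrArg (fun v : EuclideanSpace 𝕜 ι => v i) (hc j)
  rw [Matrix.mul_diagonal, mul_comm]
  simpa [Matrix.mul_apply, Module.Basis.toMatrix_apply, Matrix.mulVec, dotProduct, mul_comm] using h

theorem commute_realPart_and_imaginaryPart {A : Type*} [Ring A] [StarRing A] [Algebra ℂ A]
    [StarModule ℂ A] {a b : A} (h : Commute a b) (h' : Commute a (star b)) :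
    Commute a (ℜ b : A) ∧ Commute a (ℑ b : A) := by
  rw [realPart_apply_coe, imaginaryPart_apply_coe]
  exact ⟨(h.add_right h').smul_right _, ((h.sub_right h').smul_right _).smul_right _⟩

end SimultaneousDiagonalization

section UnitaryGroup

variable {ι κ : Type*} [Fintype ι] [DecidableEq ι]

/-- The diagonal unitary matrices, as a homomorphism from the torus. -/
def diagUnitary : (ι → Circle) →* unitaryGroup ι ℂ where
  toFun t := ⟨diagonal fun i => (t i : ℂ), by
    simp [Matrix.mem_unitaryGroup_iff, Matrix.star_eq_conjTranspose, Matrix.diagonal_conjTranspose,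
      Pi.star_def, Complex.mul_conj]⟩
  map_one' := Subtype.ext (by simp)
  map_mul' s t := Subtype.ext (by simp)

theorem coe_diagUnitary (t : ι → Circle) :
    (diagUnitary t : Matrix ι ι ℂ) = diagonal fun i => (t i : ℂ) := rfl

theorem continuous_diagUnitary : Continuous (diagUnitary (ι := ι)) :=
  Continuous.subtype_mk (Continuous.matrix_diagonal (by fun_prop)) _

theorem diagUnitary_injective : Function.Injective (diagUnitary (ι := ι)) := fun _ _ h =>
  funext fun i => Circle.ext (congrFun (Matrix.diagonal_injective (congrArg Subtype.val h)) i)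

theorem exists_eq_diagUnitary {u : unitaryGroup ι ℂ} {c : ι → ℂ}
    (hu : (u : Matrix ι ι ℂ) = diagonal c) :
    ∃ t : ι → Circle, u = diagUnitary t ∧ ∀ i, (t i : ℂ) = c i := by
  have hc : ∀ i, ‖c i‖ = 1 := fun i => by
    have h := congrFun₂ (Matrix.UnitaryGroup.star_mul_self u) i i
    rw [hu, Matrix.star_eq_conjTranspose, Matrix.diagonal_conjTranspose,
      Matrix.diagonal_mul_diagonal, Matrix.diagonal_apply_eq, Matrix.one_apply_eq] at h
    exact CStarRing.norm_of_mem_unitary (Unitary.mem_iff.mpr ⟨h, mul_comm (c i) _ ▸ h⟩)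
  exact ⟨fun i => ⟨c i, by simpa [Submonoid.unitSphere] using hc i⟩, Subtype.ext hu, fun i => rfl⟩

theorem exists_unitary_forall_eq_conj_diagUnitary {u : κ → unitaryGroup ι ℂ}
    (hu : ∀ k l, Commute (u k) (u l)) :
    ∃ g : unitaryGroup ι ℂ, ∀ k, ∃ t : ι → Circle, u k = g * diagUnitary t * g⁻¹ := by
  let A : κ ⊕ κ → Matrix ι ι ℂ :=
    Sum.elim (fun k => ↑(ℜ (u k : Matrix ι ι ℂ))) fun k => ↑(ℑ (u k : Matrix ι ι ℂ))
  have hA : ∀ p, (A p).IsHermitian := by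
    rintro (k | k) <;> exact selfAdjoint.mem_iff.mp (Subtype.prop _)
  have huA : ∀ k p, Commute (u k : Matrix ι ι ℂ) (A p) := fun k p => by
    have h (l) := commute_realPart_and_imaginaryPart (b := (u l : Matrix ι ι ℂ))
      (congrArg Subtype.val (hu k l).eq) (congrArg Subtype.val (hu k l).inv_right.eq)
    rcases p with l | l
    exacts [(h l).1, (h l).2]
  have hcomm : ∀ p q, Commute (A p) (A q) := fun p q => by
    have h (l) := commute_realPart_and_imaginaryPart (huA l p).symm <| by
      simpa only [Matrix.star_eq_conjTranspose, (hA p).eq] using (huA l p).symm.star_star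
    rcases q with l | l
    exacts [(h l).1, (h l).2]
  obtain ⟨g, hg⟩ := exists_unitary_forall_isHermitian_mul_eq hA fun p q _ => hcomm p q
  refine ⟨g, fun k => ?_⟩
  obtain ⟨c, hc⟩ := hg (.inl k)
  obtain ⟨d, hd⟩ := hg (.inr k)
  have hug : (u k : Matrix ι ι ℂ) * g = g * diagonal fun i => c i + (Complex.I • d) i := by
    rw [← realPart_add_I_smul_imaginaryPart (u k : Matrix ι ι ℂ), add_mul, smul_mul_assoc,
      ← Matrix.diagonal_add, Matrix.diagonal_smul, mul_add, mul_smul_comm]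
    exact congrArg₂ (· + Complex.I • ·) hc hd
  have hdiag : ((g⁻¹ * u k * g : unitaryGroup ι ℂ) : Matrix ι ι ℂ) =
      diagonal fun i => c i + (Complex.I • d) i := by
    rw [mul_assoc, Submonoid.coe_mul, Submonoid.coe_mul, hug, ← mul_assoc, ← Submonoid.coe_mul,
      inv_mul_cancel, Submonoid.coe_one, one_mul]
  obtain ⟨t, ht, -⟩ := exists_eq_diagUnitary hdiag
  exact ⟨t, by rw [← ht]; group⟩

theorem exists_continuous_eq_conj_diagUnitary {H : Type*} [CommGroup H] [TopologicalSpace H]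
    {f : H →* unitaryGroup ι ℂ} (hf : Continuous f) :
    ∃ (g : unitaryGroup ι ℂ) (χ : H →* (ι → Circle)), Continuous χ ∧
      ∀ h, f h = g * diagUnitary (χ h) * g⁻¹ := by
  obtain ⟨g, hg⟩ := exists_unitary_forall_eq_conj_diagUnitary (u := f) fun x y =>
    (Commute.all x y).map f
  choose χ hχ using hg
  have hconj : ∀ h, diagUnitary (χ h) = MulAut.conj g⁻¹ (f h) := fun h => by
    rw [hχ, MulAut.conj_apply]
    group
  refine ⟨g, MonoidHom.mk' χ fun x y => diagUnitary_injective ?_, ?_, hχ⟩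
  · simp only [map_mul, hconj]
  · refine (continuous_diagUnitary.isClosedEmbedding diagUnitary_injective).continuous_iff.mpr ?_
    refine Continuous.congr ?_ fun h => (hconj h).symm
    simp only [MulAut.conj_apply]
    fun_prop

theorem exists_weights {f : unitaryGroup ι ℂ →* unitaryGroup ι ℂ} (hf : Continuous f) :
    ∃ (g : unitaryGroup ι ℂ) (M : Matrix ι ι ℤ), ∀ s,
      f (diagUnitary s) = g * diagUnitary (fun j => torusChar (M j) s) * g⁻¹ := by
  obtain ⟨g, χ, hχ, hg⟩ := exists_continuous_eq_conj_diagUnitary (f := f.comp diagUnitary)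
    (hf.comp continuous_diagUnitary)
  choose M hM using fun j => exists_eq_torusChar_of_continuous
    (χ := (Pi.evalMonoidHom (fun _ => Circle) j).comp χ) ((continuous_apply j).comp hχ)
  refine ⟨g, M, fun s => (hg s).trans ?_⟩
  simp only [← hM]
  rfl

end UnitaryGroup

section Center

variable {ι : Type*} [Fintype ι] [DecidableEq ι]

/-- The scalar unitary matrices, as a homomorphism from the circle. -/
noncomputable def scalarUnitary : Circle →* unitaryGroup ι ℂ :=
  diagUnitary.comp (Pi.constMonoidHom ι Circle)

theorem scalarUnitary_apply (z : Circle) :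
    scalarUnitary (ι := ι) z = diagUnitary fun _ => z := rfl

theorem scalarUnitary_injective [Nonempty ι] : Function.Injective (scalarUnitary (ι := ι)) :=
  diagUnitary_injective.comp Function.const_injective

open scoped Matrix.Norms.L2Operator in
theorem span_unitaryGroup :
    Submodule.span ℂ (unitaryGroup ι ℂ : Set (Matrix ι ι ℂ)) = ⊤ :=
  CStarAlgebra.span_unitary _

theorem mem_range_scalar_of_forall_commute {A : Matrix ι ι ℂ}
    (hA : ∀ u : unitaryGroup ι ℂ, Commute (u : Matrix ι ι ℂ) A) :
    A ∈ Set.range (Matrix.scalar ι) := by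
  have hspan : Submodule.span ℂ (unitaryGroup ι ℂ : Set (Matrix ι ι ℂ)) ≤
      (Subalgebra.centralizer ℂ {A}).toSubmodule :=
    Submodule.span_le.mpr fun u hu =>
      Subalgebra.mem_centralizer_iff ℂ |>.mpr fun _ hB => hB ▸ (hA ⟨u, hu⟩).eq.symm
  rw [span_unitaryGroup, top_le_iff, Algebra.toSubmodule_eq_top] at hspan
  exact Matrix.mem_range_scalar_of_commute_single fun i j _ =>
    ((Subalgebra.mem_centralizer_iff ℂ).mp
      (hspan ▸ Algebra.mem_top : Matrix.single i j 1 ∈ Subalgebra.centralizer ℂ {A}) A rfl).symm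

theorem center_unitaryGroup :
    Subgroup.center (unitaryGroup ι ℂ) = (scalarUnitary (ι := ι)).range := by
  ext u
  rw [Subgroup.mem_center_iff, MonoidHom.mem_range]
  constructor
  · intro hu
    obtain ⟨c, hc⟩ := mem_range_scalar_of_forall_commute fun v => congrArg Subtype.val (hu v)
    obtain ⟨t, rfl, ht⟩ := exists_eq_diagUnitary hc.symm
    rcases isEmpty_or_nonempty ι with _ | ⟨⟨i⟩⟩
    · exact ⟨1, congrArg diagUnitary (Subsingleton.elim _ _)⟩
    · exact ⟨t i, congrArg diagUnitary (funext fun j => Circle.ext ((ht i).trans (ht j).symm))⟩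
  · rintro ⟨z, rfl⟩ v
    exact Subtype.ext (Matrix.scalar_commute (z : ℂ) (Commute.all _) (v : Matrix ι ι ℂ)).eq.symm

theorem scalarUnitary_mem_center (z : Circle) :
    scalarUnitary z ∈ Subgroup.center (unitaryGroup ι ℂ) :=
  center_unitaryGroup (ι := ι) ▸ ⟨z, rfl⟩

theorem conj_scalarUnitary (g : unitaryGroup ι ℂ) (z : Circle) :
    g * scalarUnitary z * g⁻¹ = scalarUnitary z :=
  mul_inv_eq_of_eq_mul (Subgroup.mem_center_iff.mp (scalarUnitary_mem_center z) g)

theorem exists_forall_map_scalarUnitary_eq_zpow [Nonempty ι]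
    {f : unitaryGroup ι ℂ →* unitaryGroup ι ℂ} (hf : Continuous f)
    (hsurj : Function.Surjective f) :
    ∃ k : ℤ, ∀ z, f (scalarUnitary z) = scalarUnitary (z ^ k) := by
  obtain ⟨g, M, hM⟩ := exists_weights hf
  obtain ⟨i⟩ := ‹Nonempty ι›
  refine ⟨∑ j, M i j, fun z => ?_⟩
  have hcenter : f (scalarUnitary z) ∈ Subgroup.center (unitaryGroup ι ℂ) := by
    refine Subgroup.mem_center_iff.mpr (hsurj.forall.mpr fun u => ?_)
    rw [← map_mul, ← map_mul, Subgroup.mem_center_iff.mp (scalarUnitary_mem_center z) u]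
  rw [center_unitaryGroup, MonoidHom.mem_range] at hcenter
  obtain ⟨w, hw⟩ := hcenter
  have hdiag : diagUnitary (fun j => torusChar (M j) fun _ => z) = scalarUnitary w := by
    rw [← conj_scalarUnitary g⁻¹ w, hw, scalarUnitary_apply, hM]
    group
  rw [← hw, ← torusChar_const, congrFun (diagUnitary_injective hdiag) i]
  rfl

theorem eq_self_or_eq_inv_of_mem_center [Nonempty ι] (α : unitaryGroup ι ℂ ≃ₜ* unitaryGroup ι ℂ) :
    (∀ c ∈ Subgroup.center (unitaryGroup ι ℂ), α c = c) ∨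
      ∀ c ∈ Subgroup.center (unitaryGroup ι ℂ), α c = c⁻¹ := by
  obtain ⟨k, hk⟩ := exists_forall_map_scalarUnitary_eq_zpow
    (f := (α : unitaryGroup ι ℂ →* unitaryGroup ι ℂ)) α.continuous α.surjective
  obtain ⟨l, hl⟩ := exists_forall_map_scalarUnitary_eq_zpow
    (f := (α.symm : unitaryGroup ι ℂ →* unitaryGroup ι ℂ)) α.symm.continuous α.symm.surjective
  have hkl : k * l = 1 := eq_of_forall_circle_zpow_eq fun z =>
    scalarUnitary_injective (ι := ι) <| by
      rw [zpow_mul, zpow_one, ← hl, ← hk]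
      exact α.symm_apply_apply _
  rw [center_unitaryGroup]
  rcases Int.isUnit_iff.mp (IsUnit.of_mul_eq_one _ hkl) with rfl | rfl
  · left
    rintro _ ⟨z, rfl⟩
    exact (hk z).trans (by rw [zpow_one])
  · right
    rintro _ ⟨z, rfl⟩
    exact (hk z).trans (by rw [zpow_neg_one, map_inv])

end Center

section MatrixAlgebra

variable {ι R A : Type*} [Fintype ι] [DecidableEq ι] [CommRing R] [Ring A] [Algebra R A]

theorem ker_le_ker_of_trace_eq {φ ψ : A →ₐ[R] Matrix ι ι R}
    (htr : ∀ a, (φ a).trace = (ψ a).trace) (hψ : Function.Surjective ψ) :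
    RingHom.ker φ ≤ RingHom.ker ψ := fun a ha =>
  Matrix.ext_iff_trace_mul_right.mpr <| hψ.forall.mpr fun b => by
    rw [← map_mul, ← htr, map_mul, (RingHom.mem_ker).mp ha]
    simp only [zero_mul]

theorem exists_algEquiv_apply_eq_of_trace_eq {φ ψ : A →ₐ[R] Matrix ι ι R}
    (htr : ∀ a, (φ a).trace = (ψ a).trace) (hφ : Function.Surjective φ)
    (hψ : Function.Surjective ψ) :
    ∃ L : Matrix ι ι R ≃ₐ[R] Matrix ι ι R, ∀ a, L (φ a) = ψ a := by
  have hker : RingHom.ker φ = RingHom.ker ψ :=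
    le_antisymm (ker_le_ker_of_trace_eq htr hψ)
      (ker_le_ker_of_trace_eq (fun a => (htr a).symm) hφ)
  refine ⟨(Ideal.quotientKerAlgEquivOfSurjective hφ).symm.trans
    ((Ideal.quotientEquivAlgOfEq R hker).trans (Ideal.quotientKerAlgEquivOfSurjective hψ)),
    fun a => ?_⟩
  rw [← Ideal.quotientKerAlgEquivOfSurjective_mk hφ]
  simp

theorem monoidAlgebra_lift_surjective {G : Type*} [Monoid G] {f : G →* A}
    (hf : Submodule.span R (Set.range f) = ⊤) :
    Function.Surjective (MonoidAlgebra.lift R A G f) := by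
  have hrange : Set.range f ⊆ (MonoidAlgebra.lift R A G f).toLinearMap.range := by
    rintro _ ⟨g, rfl⟩
    exact ⟨MonoidAlgebra.of R G g, MonoidAlgebra.lift_of f g⟩
  exact LinearMap.range_eq_top.mp (top_le_iff.mp (hf ▸ Submodule.span_le.mpr hrange))

theorem exists_algEquiv_apply_eq_of_character_eq {G : Type*} [Monoid G] {f g : G →* Matrix ι ι R}
    (htr : ∀ x, (f x).trace = (g x).trace) (hf : Submodule.span R (Set.range f) = ⊤)
    (hg : Submodule.span R (Set.range g) = ⊤) :
    ∃ L : Matrix ι ι R ≃ₐ[R] Matrix ι ι R, ∀ x, L (f x) = g x := by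
  have htr' : (Matrix.traceLinearMap ι R R).comp (MonoidAlgebra.lift R _ G f).toLinearMap =
      (Matrix.traceLinearMap ι R R).comp (MonoidAlgebra.lift R _ G g).toLinearMap :=
    MonoidAlgebra.lhom_ext' fun x => LinearMap.ext_ring (by simpa using htr x)
  obtain ⟨L, hL⟩ := exists_algEquiv_apply_eq_of_trace_eq (LinearMap.congr_fun htr')
    (monoidAlgebra_lift_surjective hf) (monoidAlgebra_lift_surjective hg)
  exact ⟨L, fun x => by simpa only [MonoidAlgebra.lift_of] using hL (MonoidAlgebra.of R G x)⟩

theorem exists_unitary_starAlgEquiv_eq_conj {𝕜 : Type*} [RCLike 𝕜]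
    (L : Matrix ι ι 𝕜 ≃⋆ₐ[𝕜] Matrix ι ι 𝕜) :
    ∃ g : unitaryGroup ι 𝕜, L = Unitary.conjStarAlgAut 𝕜 _ g := by
  let e := Matrix.toEuclideanCLM (n := ι) (𝕜 := 𝕜)
  obtain ⟨T, hT⟩ := ((e.symm.trans L).trans e).eq_linearIsometryEquivConjStarAlgEquiv
    (LinearMap.continuous_of_finiteDimensional
      ((e.symm.trans L).trans e).toAlgEquiv.toLinearMap)
  obtain ⟨⟨u, hu⟩, rfl⟩ := Unitary.linearIsometryEquiv.surjective T
  rw [Unitary.conjStarAlgEquiv_unitaryLinearIsometryEquiv] at hT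
  refine ⟨⟨e.symm u, Unitary.map_mem e.symm hu⟩, StarAlgEquiv.ext fun B => ?_⟩
  have hB : e (L (e.symm (e B))) = u * e B * star u := DFunLike.congr_fun hT (e B)
  have hstar : e.symm (star u) = star (e.symm u) := e.symm.map_star' u
  rw [e.symm_apply_apply] at hB
  rw [← e.symm_apply_apply (L B), hB, map_mul, map_mul, e.symm_apply_apply, hstar]
  rfl

end MatrixAlgebra

section UnitaryAutomorphisms

variable {ι : Type*} [Fintype ι] [DecidableEq ι]

theorem exists_conj_diagUnitary_eq_diagUnitary_comp (w : Equiv.Perm ι) :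
    ∃ p : unitaryGroup ι ℂ, ∀ t, diagUnitary (t ∘ w) = p * diagUnitary t * p⁻¹ := by
  refine ⟨⟨w.permMatrix ℂ, ?_⟩, fun t => eq_mul_inv_of_mul_eq (Subtype.ext ?_)⟩
  · rw [Matrix.mem_unitaryGroup_iff, Matrix.star_eq_conjTranspose, Matrix.conjTranspose_permMatrix,
      ← Matrix.permMatrix_mul, inv_mul_cancel, Matrix.permMatrix_one]
  · ext i j
    simp only [Submonoid.coe_mul, coe_diagUnitary, Matrix.mul_diagonal, Matrix.diagonal_mul,
      Equiv.Perm.permMatrix, PEquiv.toMatrix_apply, Equiv.toPEquiv_apply, Option.mem_some_iff,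
      Function.comp_apply]
    split_ifs with h <;> simp [h]

theorem trace_conj_unitary (g u : unitaryGroup ι ℂ) :
    ((g * u * g⁻¹ : unitaryGroup ι ℂ) : Matrix ι ι ℂ).trace = (u : Matrix ι ι ℂ).trace := by
  rw [Submonoid.coe_mul, Matrix.trace_mul_comm, ← Submonoid.coe_mul, ← mul_assoc, inv_mul_cancel,
    one_mul]

theorem trace_diagUnitary (t : ι → Circle) :
    (diagUnitary t : Matrix ι ι ℂ).trace = ∑ j, (t j : ℂ) :=
  Matrix.trace_diagonal _

section Weights

variable {f : unitaryGroup ι ℂ →* unitaryGroup ι ℂ} {g : unitaryGroup ι ℂ} {M : Matrix ι ι ℤ}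
  (hM : ∀ s, f (diagUnitary s) = g * diagUnitary (fun j => torusChar (M j) s) * g⁻¹)
include hM

theorem sum_weights_eq_one_of_fixes_scalars
    (hf : ∀ z, f (scalarUnitary z) = scalarUnitary z) (j : ι) : ∑ i, M j i = 1 := by
  refine eq_of_forall_circle_zpow_eq fun z => ?_
  have hdiag : diagUnitary (fun j => torusChar (M j) fun _ => z) = diagUnitary fun _ => z := by
    have hz := hM fun _ => z
    rw [← scalarUnitary_apply, hf, ← conj_scalarUnitary g] at hz
    exact (mul_left_cancel (mul_right_cancel hz)).symm
  rw [← torusChar_const, zpow_one]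
  exact congrFun (diagUnitary_injective hdiag) j

theorem trace_map_diagUnitary (s : ι → Circle) :
    (f (diagUnitary s) : Matrix ι ι ℂ).trace = ∑ j, (torusChar (M j) s : ℂ) := by
  rw [hM, trace_conj_unitary, trace_diagUnitary]

/-- Permuting the columns of `M` precomposes `f` with an inner automorphism, which does not change
the character; so the rows of `M` are permuted. -/
theorem transpose_mul_self_submatrix_weights (w : Equiv.Perm ι) :
    (Mᵀ * M).submatrix w w = Mᵀ * M := by
  obtain ⟨p, hp⟩ := exists_conj_diagUnitary_eq_diagUnitary_comp w.symm
  have hchar : ∀ s, ∑ j, (torusChar (M j ∘ w) s : ℂ) = ∑ j, (torusChar (M j) s : ℂ) := fun s => by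
    simp only [← torusChar_comp_perm, ← trace_map_diagUnitary hM]
    rw [hp, map_mul, map_mul, map_inv, trace_conj_unitary]
  ext a b
  exact sum_apply_eq_of_sum_torusChar_eq hchar fun m => m a * m b

theorem isUnit_det_weights (hf : Function.Injective f) : IsUnit M.det := by
  refine isUnit_det_of_torusChar_injective fun s t hst => diagUnitary_injective (hf ?_)
  rw [hM, hM]
  exact congrArg (fun χ => g * diagUnitary χ * g⁻¹) hst

end Weights

theorem trace_map_eq_of_fixes_scalars {f : unitaryGroup ι ℂ →* unitaryGroup ι ℂ}
    (hf : Continuous f) (hinj : Function.Injective f)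
    (hscalar : ∀ z, f (scalarUnitary z) = scalarUnitary z) (u : unitaryGroup ι ℂ) :
    (f u : Matrix ι ι ℂ).trace = (u : Matrix ι ι ℂ).trace := by
  obtain ⟨g, M, hM⟩ := exists_weights hf
  have hrow := sum_weights_eq_one_of_fixes_scalars hM hscalar
  obtain ⟨w, hw⟩ := exists_perm_of_transpose_mul_self_eq_one
    (transpose_mul_self_eq_one_of_submatrix_perm (isUnit_det_weights hM hinj) hrow
      (transpose_mul_self_submatrix_weights hM)) hrow
  obtain ⟨h, hh⟩ := exists_unitary_forall_eq_conj_diagUnitary (u := fun _ : Unit => u)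
    fun _ _ => Commute.refl u
  obtain ⟨t, rfl⟩ := hh ()
  rw [map_mul, map_mul, map_inv, trace_conj_unitary, trace_conj_unitary, trace_map_diagUnitary hM,
    trace_diagUnitary, ← Equiv.sum_comp w fun j => (t j : ℂ)]
  simp only [hw, torusChar_single_one]

theorem exists_algEquiv_apply_eq_of_trace_map_eq {f : unitaryGroup ι ℂ →* unitaryGroup ι ℂ}
    (hf : Function.Surjective f)
    (htr : ∀ u, (f u : Matrix ι ι ℂ).trace = (u : Matrix ι ι ℂ).trace) :
    ∃ L : Matrix ι ι ℂ ≃ₐ[ℂ] Matrix ι ι ℂ, ∀ u : unitaryGroup ι ℂ, L u = f u := by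
  let coe : unitaryGroup ι ℂ →* Matrix ι ι ℂ := (unitaryGroup ι ℂ).subtype
  have hspan : Submodule.span ℂ (Set.range coe) = ⊤ :=
    (congrArg (Submodule.span ℂ) Subtype.range_coe).trans span_unitaryGroup
  refine exists_algEquiv_apply_eq_of_character_eq (f := coe) (g := coe.comp f)
    (fun u => (htr u).symm) hspan ?_
  rwa [MonoidHom.coe_comp, hf.range_comp]

theorem algEquiv_map_star_of_maps_unitary {L : Matrix ι ι ℂ ≃ₐ[ℂ] Matrix ι ι ℂ}
    {f : unitaryGroup ι ℂ →* unitaryGroup ι ℂ} (hL : ∀ u : unitaryGroup ι ℂ, L u = f u)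
    (A : Matrix ι ι ℂ) : L (star A) = star (L A) := by
  have hA : A ∈ Submodule.span ℂ (unitaryGroup ι ℂ : Set (Matrix ι ι ℂ)) :=
    span_unitaryGroup (ι := ι) ▸ Submodule.mem_top
  induction hA using Submodule.span_induction with
  | mem u hu =>
    lift u to unitaryGroup ι ℂ using hu
    rw [hL, ← Matrix.UnitaryGroup.inv_val, ← Matrix.UnitaryGroup.inv_val, hL, map_inv]
  | zero => simp only [star_zero, map_zero]
  | add A B _ _ hA hB => simp only [star_add, map_add, hA, hB]
  | smul c A _ hA => simp only [star_smul, map_smul, hA]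

theorem isInnerAut_of_fixes_center {α : unitaryGroup ι ℂ ≃ₜ* unitaryGroup ι ℂ}
    (hα : ∀ c ∈ Subgroup.center (unitaryGroup ι ℂ), α c = c) : IsInnerAut α := by
  let f : unitaryGroup ι ℂ →* unitaryGroup ι ℂ := α
  have htr := trace_map_eq_of_fixes_scalars (f := f) α.continuous α.injective fun z =>
    hα _ (scalarUnitary_mem_center z)
  obtain ⟨L, hL⟩ := exists_algEquiv_apply_eq_of_trace_map_eq (f := f) α.surjective htr
  obtain ⟨g, hg⟩ := exists_unitary_starAlgEquiv_eq_conj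
    (StarAlgEquiv.ofAlgEquiv L (algEquiv_map_star_of_maps_unitary hL))
  exact ⟨g, fun u => Subtype.ext <|
    (hL u).symm.trans (DFunLike.congr_fun hg (u : Matrix ι ι ℂ))⟩

theorem inverts_center_of_isOuterAut [Nonempty ι]
    {α : unitaryGroup ι ℂ ≃ₜ* unitaryGroup ι ℂ} (hα : IsOuterAut α) :
    ∀ c ∈ Subgroup.center (unitaryGroup ι ℂ), α c = c⁻¹ :=
  (eq_self_or_eq_inv_of_mem_center α).resolve_left fun h => hα (isInnerAut_of_fixes_center h)

theorem complexConj_scalarUnitary {n : ℕ} (z : Circle) :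
    complexConj n (scalarUnitary z) = scalarUnitary z⁻¹ := by
  refine Subtype.ext (Matrix.ext fun i j => ?_)
  change star (Matrix.scalar (Fin n) (z : ℂ) i j) = Matrix.scalar (Fin n) ((z⁻¹ : Circle) : ℂ) i j
  rw [Circle.coe_inv_eq_conj, Matrix.scalar_apply, Matrix.scalar_apply, Matrix.diagonal_apply,
    Matrix.diagonal_apply, apply_ite star, star_zero, RCLike.star_def]

theorem isOuterAut_complexConj {n : ℕ} [NeZero n] : IsOuterAut (complexConj n) := by
  rintro ⟨g, hg⟩
  have hz : ∀ z : Circle, z ^ (-1 : ℤ) = z ^ (1 : ℤ) := fun z =>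
    scalarUnitary_injective (ι := Fin n) <| by
      rw [zpow_neg_one, zpow_one, ← complexConj_scalarUnitary, hg, conj_scalarUnitary]
  exact absurd (eq_of_forall_circle_zpow_eq hz) (by decide)

end UnitaryAutomorphisms

section LiftData

variable {G Γ : Type*} [Group G] [Group Γ]

/-- The data of a lift of `α` to `G ⋊ Γ`, written as `(x, γ) ↦ (α x * a γ, θ γ)`: compatibility
with products within `Γ`, and with products of an element of `Γ` and an element of `G`. -/
structure IsLiftDatum (ρ : Γ →* G ⧸ Subgroup.center G) (α : G ≃* G) (θ : MulAut Γ) (a : Γ → G) :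
    Prop where
  crossed : ∀ γ δ, a (γ * δ) = a γ * projAction ρ (θ γ) (a δ)
  intertwines : ∀ γ x, α (projAction ρ γ x) * a γ = a γ * projAction ρ (θ γ) (α x)

theorem right_apply_eq_of_map_inl {N H : Type*} [Group N] [Group H] {φ : H →* MulAut N}
    {f : N ⋊[φ] H →* N ⋊[φ] H} {a : N → N}
    (hf : ∀ x, f (SemidirectProduct.inl x) = SemidirectProduct.inl (a x)) (p : N ⋊[φ] H) :
    (f p).right = (f (SemidirectProduct.inr p.right)).right := by
  conv_lhs => rw [← SemidirectProduct.inl_left_mul_inr_right p]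
  rw [map_mul, hf, SemidirectProduct.mul_right, SemidirectProduct.right_inl, one_mul]

theorem exists_mulAut_right_map_inr {N H : Type*} [Group N] [Group H] {φ : H →* MulAut N}
    {Φ : N ⋊[φ] H ≃* N ⋊[φ] H} {α : N ≃* N}
    (hΦ : ∀ x, Φ (SemidirectProduct.inl x) = SemidirectProduct.inl (α x)) :
    ∃ θ : MulAut H, ∀ h, (Φ (SemidirectProduct.inr h)).right = θ h := by
  have hΦ' : ∀ x, Φ.symm (SemidirectProduct.inl x) = SemidirectProduct.inl (α.symm x) := fun x => by
    rw [MulEquiv.symm_apply_eq, hΦ, MulEquiv.apply_symm_apply]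
  let quot (f : N ⋊[φ] H →* N ⋊[φ] H) : H →* H :=
    SemidirectProduct.rightHom.comp (f.comp SemidirectProduct.inr)
  refine ⟨MonoidHom.toMulEquiv (quot Φ) (quot Φ.symm) (MonoidHom.ext fun h => ?_)
    (MonoidHom.ext fun h => ?_), fun _ => rfl⟩
  · exact (right_apply_eq_of_map_inl (f := Φ.symm.toMonoidHom) hΦ' _).symm.trans
      (congrArg SemidirectProduct.right (Φ.symm_apply_apply _))
  · exact (right_apply_eq_of_map_inl (f := Φ.toMonoidHom) hΦ _).symm.trans
      (congrArg SemidirectProduct.right (Φ.apply_symm_apply _))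

variable {ρ : Γ →* G ⧸ Subgroup.center G}

theorem IsLiftDatum.apply_one {α : G ≃* G} {θ : MulAut Γ} {a : Γ → G}
    (h : IsLiftDatum ρ α θ a) : a 1 = 1 := by
  have h1 := h.crossed 1 1
  rw [mul_one, map_one, map_one, MulAut.one_apply] at h1
  exact left_eq_mul.mp h1

theorem isLiftDatum_of_map_inl {Φ : ProjSemidirect ρ ≃* ProjSemidirect ρ} {α : G ≃* G}
    {θ : MulAut Γ} (hΦ : ∀ x, Φ (SemidirectProduct.inl x) = SemidirectProduct.inl (α x))
    (hθ : ∀ γ, (Φ (SemidirectProduct.inr γ)).right = θ γ) :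
    IsLiftDatum ρ α θ fun γ => (Φ (SemidirectProduct.inr γ)).left where
  crossed γ δ := by rw [map_mul, map_mul, SemidirectProduct.mul_left, hθ]
  intertwines γ x := by
    have hcomm : (SemidirectProduct.inl (projAction ρ γ x) * SemidirectProduct.inr γ :
        ProjSemidirect ρ) = SemidirectProduct.inr γ * SemidirectProduct.inl x := by
      rw [SemidirectProduct.inl_aut, map_inv, inv_mul_cancel_right]
    simpa only [map_mul, hΦ, hθ, SemidirectProduct.mul_left, SemidirectProduct.left_inl,
      SemidirectProduct.right_inl, map_one, MulAut.one_apply] using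
      congrArg (fun p => (Φ p).left) hcomm

/-- The automorphism `(x, γ) ↦ (α x * a γ, θ γ)` of `G ⋊ Γ`. -/
def IsLiftDatum.mulEquiv {α : G ≃* G} {θ : MulAut Γ} {a : Γ → G} (h : IsLiftDatum ρ α θ a) :
    ProjSemidirect ρ ≃* ProjSemidirect ρ where
  toFun p := ⟨α p.left * a p.right, θ p.right⟩
  invFun p := ⟨α.symm (p.left * (a (θ.symm p.right))⁻¹), θ.symm p.right⟩
  left_inv p := by ext <;> simp
  right_inv p := by ext <;> simp
  map_mul' p q := by
    refine SemidirectProduct.ext ?_ (map_mul θ _ _)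
    change α (p.left * projAction ρ p.right q.left) * a (p.right * q.right) =
      α p.left * a p.right * projAction ρ (θ p.right) (α q.left * a q.right)
    rw [map_mul, map_mul, h.crossed, ← mul_assoc, mul_assoc (α p.left), h.intertwines]
    simp only [mul_assoc]

section Topology

variable [TopologicalSpace G] [TopologicalSpace Γ]

theorem continuous_semidirect_mk [DiscreteTopology Γ] {f : G → Γ → G}
    (hf : ∀ γ, Continuous fun x => f x γ) (k : Γ → Γ) :
    Continuous fun p : ProjSemidirect ρ =>
      (⟨f p.left p.right, k p.right⟩ : ProjSemidirect ρ) := by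
  have hpair : Continuous fun q : G × Γ => (f q.1 q.2, k q.2) :=
    (continuous_prod_of_discrete_right.mpr hf).prodMk
      (continuous_of_discreteTopology.comp continuous_snd)
  exact continuous_induced_rng.mpr (hpair.comp
    (continuous_induced_dom (f := fun p : ProjSemidirect ρ => (p.left, p.right))))

theorem IsLiftDatum.liftsToSemidirect [ContinuousMul G] [DiscreteTopology Γ] {α : G ≃ₜ* G}
    {θ : MulAut Γ} {a : Γ → G} (h : IsLiftDatum ρ (α : G ≃* G) θ a) : LiftsToSemidirect ρ α := by
  refine ⟨{ h.mulEquiv with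
    continuous_toFun := continuous_semidirect_mk (f := fun x γ => α x * a γ)
      (fun γ => α.continuous.mul_const _) θ
    continuous_invFun := continuous_semidirect_mk (f := fun x γ => α.symm (x * (a (θ.symm γ))⁻¹))
      (fun γ => α.symm.continuous.comp (continuous_mul_const _)) θ.symm },
    fun x => SemidirectProduct.ext ?_ (map_one θ)⟩
  exact (congrArg (α x * ·) h.apply_one).trans (mul_one _)

theorem liftsToSemidirect_iff_exists_isLiftDatum [ContinuousMul G] [DiscreteTopology Γ]
    {α : G ≃ₜ* G} : LiftsToSemidirect ρ α ↔ ∃ θ a, IsLiftDatum ρ (α : G ≃* G) θ a := by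
  refine ⟨fun ⟨Φ, hΦ⟩ => ?_, fun ⟨_, _, h⟩ => h.liftsToSemidirect⟩
  obtain ⟨θ, hθ⟩ := exists_mulAut_right_map_inr (Φ := (Φ : ProjSemidirect ρ ≃* ProjSemidirect ρ))
    (α := (α : G ≃* G)) hΦ
  exact ⟨θ, _, isLiftDatum_of_map_inl hΦ hθ⟩

theorem liftsToSemidirect_of_isInnerAut [ContinuousMul G] [DiscreteTopology Γ] {α : G ≃ₜ* G}
    (hα : IsInnerAut α) : LiftsToSemidirect ρ α := by
  obtain ⟨g, hg⟩ := hα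
  change ∀ x, (α : G ≃* G) x = g * x * g⁻¹ at hg
  have hdatum : IsLiftDatum ρ (α : G ≃* G) 1 fun γ => g * (projAction ρ γ g)⁻¹ :=
    { crossed := fun γ δ => by simp [mul_assoc]
      intertwines := fun γ x => by simp [hg, mul_assoc] }
  exact hdatum.liftsToSemidirect

end Topology

theorem projAction_apply_of_lift {g : G} {γ : Γ} (hg : (g : G ⧸ Subgroup.center G) = ρ γ) (x : G) :
    projAction ρ γ x = g * x * g⁻¹ := by
  rw [projAction, MonoidHom.comp_apply, ← hg, conjModCenter_mk]

theorem forall_conj_intertwines_iff_mem_center (α : G ≃* G) (a g h : G) :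
    (∀ x, α (g * x * g⁻¹) * a = a * (h * α x * h⁻¹)) ↔
      a * h * (α g)⁻¹ ∈ Subgroup.center G := by
  rw [Subgroup.mem_center_iff]
  refine ((MulAut.conj g).trans α).toEquiv.forall_congr fun x => ?_
  change _ ↔ α (g * x * g⁻¹) * _ = _ * α (g * x * g⁻¹)
  rw [← mul_left_inj (h * (α g)⁻¹)]
  simp only [map_mul, map_inv, mul_assoc, inv_mul_cancel_left]

end LiftData

section CoboundaryCriterion

open scoped IsMulCommutative

variable {G : Type} {Γ : Type u} [Group G] [Group Γ] {ρ : Γ →* G ⧸ Subgroup.center G}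
  {r : Γ → G}

theorem lift_mul_lift (hr : ∀ γ, (r γ : G ⧸ Subgroup.center G) = ρ γ) (g h : Γ) :
    r g * r h = projCocycle ρ r hr (g, h) * r (g * h) :=
  (inv_mul_cancel_right _ _).symm

variable {α : G ≃* G} (hα : ∀ c ∈ Subgroup.center G, α c = c⁻¹) {θ : MulAut Γ}
include hα

theorem map_lift_mul (hr : ∀ γ, (r γ : G ⧸ Subgroup.center G) = ρ γ) (g h : Γ) :
    α (r (g * h)) = projCocycle ρ r hr (g, h) * (α (r g) * α (r h)) := by
  rw [← map_mul, lift_mul_lift hr, map_mul, hα _ (Subtype.prop _), mul_inv_cancel_left]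

theorem crossed_iff_cocycle_mul_eq (hr : ∀ γ, (r γ : G ⧸ Subgroup.center G) = ρ γ) {a : Γ → G}
    {c : Γ → Subgroup.center G} (hac : ∀ γ, a γ * r (θ γ) = c γ * α (r γ)) (g h : Γ) :
    a (g * h) = a g * projAction ρ (θ g) (a h) ↔
      projCocycle ρ r hr (θ g, θ h) * projCocycle ρ r hr (g, h) * c (g * h) = c g * c h := by
  set z := projCocycle ρ r hr (g, h)
  set z' := projCocycle ρ r hr (θ g, θ h)
  have hcomm : ∀ (x : Subgroup.center G) (y : G), y * x = x * y := fun x y =>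
    Subgroup.mem_center_iff.mp x.2 y
  have hleft : a (g * h) * (r (θ g) * r (θ h)) =
      (z' * z * c (g * h) : Subgroup.center G) * (α (r g) * α (r h)) := by
    calc a (g * h) * (r (θ g) * r (θ h))
        = a (g * h) * z' * r (θ (g * h)) := by rw [lift_mul_lift hr, map_mul, mul_assoc]
      _ = (z' * c (g * h) * z : Subgroup.center G) * (α (r g) * α (r h)) := by
        rw [hcomm, mul_assoc, hac, map_lift_mul hα hr]
        simp only [Subgroup.coe_mul, mul_assoc, z]
      _ = _ := by rw [mul_right_comm]
  have hright : a g * projAction ρ (θ g) (a h) * (r (θ g) * r (θ h)) =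
      (c g * c h : Subgroup.center G) * (α (r g) * α (r h)) := by
    calc a g * projAction ρ (θ g) (a h) * (r (θ g) * r (θ h))
        = a g * r (θ g) * (a h * r (θ h)) := by rw [projAction_apply_of_lift (hr _)]; group
      _ = c g * (α (r g) * c h) * α (r h) := by rw [hac, hac]; group
      _ = _ := by rw [hcomm]; simp only [Subgroup.coe_mul, mul_assoc]
  rw [← mul_left_inj (r (θ g) * r (θ h)), hleft, hright, mul_left_inj, Subtype.coe_inj]

theorem exists_isLiftDatum_iff_exists_coboundary
    (hr : ∀ γ, (r γ : G ⧸ Subgroup.center G) = ρ γ) :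
    (∃ a, IsLiftDatum ρ α θ a) ↔ ∃ c : Γ → Subgroup.center G, ∀ g h,
      projCocycle ρ r hr (θ g, θ h) * projCocycle ρ r hr (g, h) * c (g * h) = c g * c h := by
  constructor
  · rintro ⟨a, ha⟩
    have hcenter : ∀ γ, a γ * r (θ γ) * (α (r γ))⁻¹ ∈ Subgroup.center G := fun γ =>
      (forall_conj_intertwines_iff_mem_center α _ _ _).mp fun x => by
        simpa only [projAction_apply_of_lift (hr _)] using ha.intertwines γ x
    let c (γ : Γ) : Subgroup.center G := ⟨_, hcenter γ⟩
    exact ⟨c, fun g h => (crossed_iff_cocycle_mul_eq hα hr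
      (fun γ => (inv_mul_cancel_right _ _).symm) g h).mp (ha.crossed g h)⟩
  · rintro ⟨c, hc⟩
    refine ⟨fun γ => c γ * α (r γ) * (r (θ γ))⁻¹, fun g h => ?_, fun γ x => ?_⟩
    · exact (crossed_iff_cocycle_mul_eq hα hr (fun γ => inv_mul_cancel_right _ _) g h).mpr (hc g h)
    · rw [projAction_apply_of_lift (hr _), projAction_apply_of_lift (hr _)]
      refine (forall_conj_intertwines_iff_mem_center α _ _ _).mpr ?_ x
      rw [inv_mul_cancel_right, mul_inv_cancel_right]
      exact (c γ).2

end CoboundaryCriterion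

section Cohomology

open groupCohomology CategoryTheory
open scoped IsMulCommutative

variable {G : Type} {Γ : Type u} [Group G] [Group Γ] {ρ : Γ →* G ⧸ Subgroup.center G}
  {r : Γ → G} (hr : ∀ γ, (r γ : G ⧸ Subgroup.center G) = ρ γ)

theorem pullbackH2_projClass (f : Γ →* Γ) :
    (pullbackH2 (Subgroup.center G) f).hom (projClass ρ r hr) =
      (H2π (trivialCoeff Γ (Subgroup.center G))).hom
        (mapCocycles₂ f (Rep.ofHom ⟨LinearMap.id, fun _ => rfl⟩ :
          Rep.res f (trivialCoeff Γ (Subgroup.center G)) ⟶ trivialCoeff Γ (Subgroup.center G))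
          (projCocycle₂ ρ r hr)) :=
  H2π_comp_map_apply (A := trivialCoeff Γ (Subgroup.center G)) f _ (projCocycle₂ ρ r hr)

theorem pullbackH2_projClass_eq_neg_iff (f : Γ →* Γ) :
    (pullbackH2 (Subgroup.center G) f).hom (projClass ρ r hr) = -projClass ρ r hr ↔
      ∃ c : Γ → Subgroup.center G, ∀ g h, projCocycle ρ r hr (f g, f h) *
        projCocycle ρ r hr (g, h) * c (g * h) = c g * c h := by
  have hdiv : ∀ (c : Γ → Subgroup.center G) g h, projCocycle ρ r hr (f g, f h) *
      projCocycle ρ r hr (g, h) * c (g * h) = c g * c h ↔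
      c h / c (g * h) * c g = projCocycle ρ r hr (f g, f h) * projCocycle ρ r hr (g, h) :=
    fun c g h => by rw [div_mul_eq_mul_div, div_eq_iff_eq_mul, mul_comm (c h), eq_comm]
  simp only [hdiv]
  rw [pullbackH2_projClass, projClass, ← map_neg]
  refine (H2π_eq_iff _ _).trans ⟨fun ⟨x, hx⟩ => ⟨fun γ => (x γ).down.toMul, fun g h => ?_⟩,
    fun ⟨c, hc⟩ => ⟨fun γ => ULift.up (Additive.ofMul (c γ)), funext fun ⟨g, h⟩ => ?_⟩⟩
  · exact congrArg (fun t => t.down.toMul) ((congrFun hx (g, h)).trans (sub_neg_eq_add _ _))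
  · exact (congrArg (fun t => ULift.up (Additive.ofMul t)) (hc g h)).trans
      (sub_neg_eq_add _ _).symm

theorem neg_projClass_mem_orbit_iff :
    -projClass ρ r hr ∈ MulAction.orbit (MulAut Γ) (projClass ρ r hr) ↔
      ∃ (θ : MulAut Γ) (c : Γ → Subgroup.center G), ∀ g h, projCocycle ρ r hr (θ g, θ h) *
        projCocycle ρ r hr (g, h) * c (g * h) = c g * c h := by
  refine (Equiv.inv (MulAut Γ)).exists_congr fun θ => ?_
  exact pullbackH2_projClass_eq_neg_iff hr (θ⁻¹ : MulAut Γ).toMonoidHom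

theorem liftsToSemidirect_iff_neg_projClass_mem_orbit [TopologicalSpace G] [ContinuousMul G]
    [TopologicalSpace Γ] [DiscreteTopology Γ] {α : G ≃ₜ* G}
    (hα : ∀ c ∈ Subgroup.center G, α c = c⁻¹) :
    LiftsToSemidirect ρ α ↔
      -projClass ρ r hr ∈ MulAction.orbit (MulAut Γ) (projClass ρ r hr) := by
  rw [liftsToSemidirect_iff_exists_isLiftDatum, neg_projClass_mem_orbit_iff]
  exact exists_congr fun θ => exists_isLiftDatum_iff_exists_coboundary (α := (α : G ≃* G)) hα hr

end Cohomology

/-- Here `z̄` is written additively, so that its inverse is `-z̄`. The third condition is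
about an arbitrary fixed outer automorphism `σ`, and complex conjugation is one. -/
theorem corollary1p9 {n : ℕ} (hn : 1 ≤ n)
    {Γ : Type u} [Group Γ] [TopologicalSpace Γ] [DiscreteTopology Γ]
    (ρ : Γ →* PU n) (r : Γ → U n) (hr : ∀ γ, (r γ : PU n) = ρ γ) :
    IsOuterAut (complexConj n) ∧
    ∀ σ : U n ≃ₜ* U n, IsOuterAut σ →
      List.TFAE [
        ∀ α : U n ≃ₜ* U n, LiftsToSemidirect ρ α,
        ∀ α : U n ≃ₜ* U n, IsOuterAut α → LiftsToSemidirect ρ α,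
        LiftsToSemidirect ρ σ,
        -projClass ρ r hr ∈ MulAction.orbit (MulAut Γ) (projClass ρ r hr)] := by
  have : NeZero n := ⟨Nat.one_le_iff_ne_zero.mp hn⟩
  have hiff : ∀ α : U n ≃ₜ* U n, IsOuterAut α → (LiftsToSemidirect ρ α ↔
      -projClass ρ r hr ∈ MulAction.orbit (MulAut Γ) (projClass ρ r hr)) := fun α hα =>
    liftsToSemidirect_iff_neg_projClass_mem_orbit hr (inverts_center_of_isOuterAut hα)
  refine ⟨isOuterAut_complexConj, fun σ hσ => ?_⟩
  tfae_have 1 → 2 := fun h α _ => h α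
  tfae_have 2 → 3 := fun h => h σ hσ
  tfae_have 3 → 4 := (hiff σ hσ).mp
  tfae_have 4 → 1 := fun h α =>
    (em (IsInnerAut α)).elim liftsToSemidirect_of_isInnerAut fun hα => (hiff α hα).mpr h
  tfae_finish
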